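/- An ordered Bratteli diagram consists of finite nonempty vertex sets $V_n$ ($n\ge 0$), with $V_0$ a single vertex (the root), and finite nonempty edge sets $E_n$ of edges from $V_n$ to $V_{n+1}$ (multiple edges allowed), such that every vertex has an outgoing edge, every vertex other than the root has an incoming edge, and the edges entering each vertex are totally ordered. Let $X$ be the space of infinite paths $x=x_0x_1\dots$ ($x_i\in E_i$) from the root, with the topology in which paths are close when they agree on a long initial segment; $X$ is assumed to be homeomorphic to the Cantor set. Put $x<y$ if for some $N$ we have $x_n=y_n$ for all $n>N$ and $x_N<y_N$. A path is minimal (maximal) if all its edges are minimal (maximal) among the edges entering the same vertex. The diagram is assumed to be properly ordered (there are a unique minimal path and a unique maximal path) and simple (for some levels $0=l_0<l_1<l_2<\cdots$, every vertex at level $l_i$ is connected by a downward path to every vertex at level $l_{i+1}$, for all $i$). The Vershik map $T:X\to X$, a bijection, maps each nonmaximal path $x$ to its successor, the smallest $y>x$, and the maximal path to the minimal path. In what follows a system is a pair $(X,T)$ arising in this way. Two systems are conjugate if there is an equivariant homeomorphism between their path spaces that maps the minimal path to the minimal path. The $k$-coding of $x\in X$ is the sequence, indexed by $n\in\mathbb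 Z$, of the initial segments of $T^nx$ from the root to level $k$. A system is nonexpansive if for every $k\ge 1$ there are two distinct paths with the same $k$-coding. A depth $k$ pair is a pair of distinct paths with the same $k$-coding but different $(k+1)$-codings. A pair $x,x'$ has a $j$ cut if there is $m\in\mathbb Z$ such that the initial segments of $T^mx$ and of $T^mx'$ from the root to level $j$ consist of minimal edges. A nonexpansive system is well timed if for every $k\ge 1$ and every $j>k$ there is a depth $k$ pair with a $j$ cut; a nonexpansive system is untimed if for every $k\ge 1$ there is $j>k$ such that no depth $k$ pair has a $j$ cut. Theorem. Let $NE$ be the class of nonexpansive systems, $CW$ the class of systems conjugate to some well timed system, and $CU$ the class of systems conjugate to some untimed system. Then $$NE = CW\sqcup CU,$$ that is, $NE=CW\cup CU$ and $CW\cap CU=\emptyset$. -/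

import Mathlib

/-- An ordered Bratteli diagram: `V n` is the set of vertices at level `n` (level `0` is the root),
`E n` is the set of edges from level `n` to level `n + 1` (multiple edges are allowed). The orders on
the sets of edges entering each vertex are recorded as one partial order on each `E n`, in which two
edges are comparable exactly when they enter the same vertex. -/
structure OrderedBratteliDiagram where
  V : ℕ → Type
  E : ℕ → Type
  finite_V : ∀ n, Finite (V n)
  nonempty_V : ∀ n, Nonempty (V n)
  subsingleton_root : Subsingleton (V 0)
  finite_E : ∀ n, Finite (E n)
  nonempty_E : ∀ n, Nonempty (E n)
  source : ∀ {n}, E n → V n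
  target : ∀ {n}, E n → V (n + 1)
  exists_outgoing : ∀ {n} (v : V n), ∃ e : E n, source e = v
  exists_incoming : ∀ {n} (v : V (n + 1)), ∃ e : E n, target e = v
  edgeOrder : ∀ n, PartialOrder (E n)
  comparable_iff : ∀ {n} (e f : E n), (e ≤ f ∨ f ≤ e) ↔ target e = target f

namespace OrderedBratteliDiagram

instance (D : OrderedBratteliDiagram) (n : ℕ) : PartialOrder (D.E n) := D.edgeOrder n

instance (D : OrderedBratteliDiagram) (n : ℕ) : TopologicalSpace (D.E n) := ⊥

instance (D : OrderedBratteliDiagram) (n : ℕ) : DiscreteTopology (D.E n) := ⟨rfl⟩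

/-- Infinite paths starting at the root. -/
def Path (D : OrderedBratteliDiagram) : Type :=
  {x : ∀ n, D.E n // ∀ n, D.target (x n) = D.source (x (n + 1))}

/-- The path space carries the topology of edgewise convergence: paths are close when they agree
on a long initial segment. -/
instance (D : OrderedBratteliDiagram) : TopologicalSpace D.Path :=
  inferInstanceAs (TopologicalSpace
    {x : ∀ n, D.E n // ∀ n, D.target (x n) = D.source (x (n + 1))})

/-- `x.edge n` is the edge of the path `x` from level `n` to level `n + 1`. -/
def Path.edge {D : OrderedBratteliDiagram} (x : D.Path) (n : ℕ) : D.E n := x.1 n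

/-- The order on paths: `x < y` if `x` and `y` are cofinal and, at the last place where they
differ, the edge of `x` is smaller than the edge of `y`. -/
def Path.Lt {D : OrderedBratteliDiagram} (x y : D.Path) : Prop :=
  ∃ N, x.edge N < y.edge N ∧ ∀ n, N < n → x.edge n = y.edge n

/-- All edges of the path are minimal among the edges entering the same vertex. -/
def Path.IsMinimal {D : OrderedBratteliDiagram} (x : D.Path) : Prop := ∀ n, IsMin (x.edge n)

/-- All edges of the path are maximal among the edges entering the same vertex. -/
def Path.IsMaximal {D : OrderedBratteliDiagram} (x : D.Path) : Prop := ∀ n, IsMax (x.edge n)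

/-- The initial segment of `x` from the root to level `j` consists of minimal edges. -/
def Path.MinimalInto {D : OrderedBratteliDiagram} (j : ℕ) (x : D.Path) : Prop :=
  ∀ n, n < j → IsMin (x.edge n)

/-- `y` is the successor of `x`: the smallest path that is larger than `x`. -/
def Path.IsSuccessor {D : OrderedBratteliDiagram} (x y : D.Path) : Prop :=
  x.Lt y ∧ ∀ z, x.Lt z → y = z ∨ y.Lt z

/-- There is a unique minimal path and a unique maximal path. -/
def ProperlyOrdered (D : OrderedBratteliDiagram) : Prop :=
  (∃! x : D.Path, x.IsMinimal) ∧ (∃! x : D.Path, x.IsMaximal)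

/-- `D.Reaches v w`: there is a finite (downward) path of edges from the vertex `v` to the vertex
`w`. -/
inductive Reaches (D : OrderedBratteliDiagram) {m : ℕ} (v : D.V m) : ∀ {n : ℕ}, D.V n → Prop
  | refl : Reaches D v v
  | step {n : ℕ} (e : D.E n) : Reaches D v (D.source e) → Reaches D v (D.target e)

/-- The diagram has a telescoping, to levels `0 = l 0 < l 1 < l 2 < ⋯`, with complete connections
between adjacent levels; the edges of the telescoping are the finite paths from level `l i` to
level `l (i + 1)`. -/
def Simple (D : OrderedBratteliDiagram) : Prop :=
  ∃ l : ℕ → ℕ, l 0 = 0 ∧ StrictMono l ∧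
    ∀ (i : ℕ) (v : D.V (l i)) (w : D.V (l (i + 1))), D.Reaches v w

section VershikMap

variable {D : OrderedBratteliDiagram}

theorem Path.ext' {x y : D.Path} (h : ∀ n, x.edge n = y.edge n) : x = y :=
  Subtype.ext (funext h)

theorem Path.Lt.irrefl (x : D.Path) : ¬ x.Lt x := fun ⟨_, h, _⟩ => lt_irrefl _ h

theorem Path.Lt.trans {x y z : D.Path} (h : x.Lt y) (h' : y.Lt z) : x.Lt z := by
  obtain ⟨N, hN, hN'⟩ := h
  obtain ⟨M, hM, hM'⟩ := h'
  rcases lt_trichotomy N M with hl | rfl | hl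
  · exact ⟨M, by rw [hN' M hl]; exact hM,
      fun n hn => (hN' n (hl.trans hn)).trans (hM' n hn)⟩
  · exact ⟨N, hN.trans hM, fun n hn => (hN' n hn).trans (hM' n hn)⟩
  · exact ⟨N, by rw [← hM' N hl]; exact hN,
      fun n hn => (hN' n hn).trans (hM' n (hl.trans hn))⟩

/-- Cofinal paths are comparable. -/
theorem Path.lt_trichotomy_of_cofinal {x y : D.Path} (N : ℕ)
    (h : ∀ n, N ≤ n → x.edge n = y.edge n) : x.Lt y ∨ x = y ∨ y.Lt x := by
  induction N with
  | zero => exact Or.inr (Or.inl (Path.ext' fun n => h n (Nat.zero_le n)))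
  | succ N ih =>
    by_cases hN : x.edge N = y.edge N
    · refine ih fun n hn => ?_
      rcases hn.eq_or_lt with rfl | hn
      · exact hN
      · exact h n hn
    · have ht : D.target (x.edge N) = D.target (y.edge N) := by
        rw [show D.target (x.edge N) = D.source (x.edge (N + 1)) from x.2 N,
          show D.target (y.edge N) = D.source (y.edge (N + 1)) from y.2 N, h (N + 1) le_rfl]
      rcases (D.comparable_iff _ _).2 ht with hle | hle
      · exact Or.inl ⟨N, lt_of_le_of_ne hle hN, fun n hn => h n hn⟩
      · exact Or.inr (Or.inr ⟨N, lt_of_le_of_ne hle (Ne.symm hN), fun n hn => (h n hn).symm⟩)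

theorem Path.Lt.cofinal {x y : D.Path} (h : x.Lt y) :
    ∃ N, ∀ n, N ≤ n → x.edge n = y.edge n := by
  obtain ⟨N, _, h⟩ := h
  exact ⟨N + 1, h⟩

/-- A sequence of edges that is connected from level `n` on is the tail of a path. -/
theorem exists_path_tail (n : ℕ) : ∀ g : ∀ i, D.E i,
    (∀ i, n ≤ i → D.target (g i) = D.source (g (i + 1))) →
      ∃ y : D.Path, ∀ i, n ≤ i → y.edge i = g i := by
  induction n with
  | zero => exact fun g hg => ⟨⟨g, fun i => hg i (Nat.zero_le i)⟩, fun _ _ => rfl⟩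
  | succ n ih =>
    intro g hg
    obtain ⟨e, he⟩ := D.exists_incoming (D.source (g (n + 1)))
    obtain ⟨y, hy⟩ := ih (Function.update g n e) (by
      intro i hi
      rcases hi.eq_or_lt with rfl | hi
      · rw [Function.update_self, Function.update_of_ne (by omega), he]
      · rw [Function.update_of_ne (by omega), Function.update_of_ne (by omega)]
        exact hg i hi)
    refine ⟨y, fun i hi => ?_⟩
    rw [hy i (by omega), Function.update_of_ne (by omega)]

/-- Replacing the edge of `x` at level `n` by another edge entering the same vertex. -/
theorem exists_path_change (x : D.Path) (n : ℕ) (e : D.E n)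
    (he : D.target e = D.target (x.edge n)) :
    ∃ y : D.Path, y.edge n = e ∧ ∀ i, n < i → y.edge i = x.edge i := by
  obtain ⟨y, hy⟩ := exists_path_tail n (Function.update x.1 n e) (by
    intro i hi
    rcases hi.eq_or_lt with rfl | hi
    · rw [Function.update_self, Function.update_of_ne (by omega), he]
      exact x.2 _
    · rw [Function.update_of_ne (by omega), Function.update_of_ne (by omega)]
      exact x.2 i)
  refine ⟨y, by rw [hy n le_rfl, Function.update_self], fun i hi => ?_⟩
  rw [hy i hi.le, Function.update_of_ne (by omega)]
  rfl

theorem finite_cofinal (x : D.Path) (N : ℕ) :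
    {y : D.Path | ∀ n, N < n → y.edge n = x.edge n}.Finite := by
  have : ∀ n, Finite (D.E n) := D.finite_E
  refine Set.Finite.of_finite_image
    (f := fun (y : D.Path) (i : Fin (N + 1)) => y.edge i) (Set.toFinite _) ?_
  intro y hy z hz hyz
  refine Path.ext' fun n => ?_
  rcases Nat.lt_or_ge N n with hn | hn
  · rw [hy n hn, hz n hn]
  · exact congrFun hyz ⟨n, by omega⟩

theorem exists_lt_minimal {S : Set D.Path} (hf : S.Finite) (hne : S.Nonempty) :
    (∃ y ∈ S, ∀ z ∈ S, ¬ z.Lt y) ∧ (∃ y ∈ S, ∀ z ∈ S, ¬ y.Lt z) := by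
  let _ : PartialOrder D.Path :=
    { le := fun x y => x = y ∨ x.Lt y
      lt := Path.Lt
      le_refl := fun _ => Or.inl rfl
      le_trans := by
        rintro x y z (rfl | h) (rfl | h')
        · exact Or.inl rfl
        · exact Or.inr h'
        · exact Or.inr h
        · exact Or.inr (h.trans h')
      lt_iff_le_not_ge := by
        intro x y
        constructor
        · intro h
          refine ⟨Or.inr h, ?_⟩
          rintro (rfl | h')
          · exact Path.Lt.irrefl _ h
          · exact Path.Lt.irrefl _ (h.trans h')
        · rintro ⟨rfl | h, h'⟩
          · exact absurd (Or.inl rfl) h'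
          · exact h
      le_antisymm := by
        rintro x y (rfl | h) (h' | h')
        · rfl
        · rfl
        · exact h'.symm
        · exact absurd (h.trans h') (Path.Lt.irrefl _) }
  constructor
  · obtain ⟨y, hy⟩ := hf.exists_minimal hne
    exact ⟨y, hy.1, fun z hz h => hy.not_lt hz h⟩
  · obtain ⟨y, hy⟩ := hf.exists_maximal hne
    exact ⟨y, hy.1, fun z hz h => hy.not_gt hz h⟩

/-- Every nonmaximal path has a successor. -/
theorem exists_isSuccessor (x : D.Path) (hx : ¬ x.IsMaximal) : ∃ y, x.IsSuccessor y := by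
  classical
  obtain ⟨N, hN, hmin⟩ : ∃ N, ¬ IsMax (x.edge N) ∧ ∀ n, n < N → IsMax (x.edge n) := by
    have h : ∃ N, ¬ IsMax (x.edge N) := not_forall.1 hx
    exact ⟨Nat.find h, Nat.find_spec h, fun n hn => not_not.1 (Nat.find_min h hn)⟩
  obtain ⟨e, he⟩ := not_isMax_iff.1 hN
  obtain ⟨y₀, hy₀, hy₀'⟩ :=
    exists_path_change x N e ((D.comparable_iff _ _).1 (Or.inr he.le))
  obtain ⟨y, ⟨hy, hxy⟩, hmin'⟩ := (exists_lt_minimal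
    (S := {y : D.Path | (∀ n, N < n → y.edge n = x.edge n) ∧ x.Lt y})
    ((finite_cofinal x N).subset fun _ h => h.1)
    ⟨y₀, hy₀', N, by rw [hy₀]; exact he, fun n hn => (hy₀' n hn).symm⟩).1
  refine ⟨y, hxy, fun z hz => ?_⟩
  obtain ⟨M, hM, hM'⟩ := id hz
  rcases lt_trichotomy M N with hl | rfl | hl
  · exact absurd hM (hmin M hl).not_lt
  · have hzS : ∀ n, M < n → z.edge n = x.edge n := fun n hn => (hM' n hn).symm
    rcases Path.lt_trichotomy_of_cofinal (M + 1)
        (fun n hn => (hy n hn).trans (hzS n hn).symm) with h | h | h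
    · exact Or.inr h
    · exact Or.inl h
    · exact absurd h (hmin' z ⟨hzS, hz⟩)
  · exact Or.inr ⟨M, by rw [hy M hl]; exact hM, fun n hn =>
      (hy n (hl.trans hn)).trans (hM' n hn)⟩

/-- Every nonminimal path is a successor. -/
theorem exists_isSuccessor_of (y : D.Path) (hy : ¬ y.IsMinimal) :
    ∃ x : D.Path, x.IsSuccessor y := by
  classical
  obtain ⟨N, hN, hmin⟩ : ∃ N, ¬ IsMin (y.edge N) ∧ ∀ n, n < N → IsMin (y.edge n) := by
    have h : ∃ N, ¬ IsMin (y.edge N) := not_forall.1 hy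
    exact ⟨Nat.find h, Nat.find_spec h, fun n hn => not_not.1 (Nat.find_min h hn)⟩
  obtain ⟨e, he⟩ := not_isMin_iff.1 hN
  obtain ⟨x₀, hx₀, hx₀'⟩ :=
    exists_path_change y N e ((D.comparable_iff _ _).1 (Or.inl he.le))
  obtain ⟨x, ⟨hx, hxy⟩, hmax⟩ := (exists_lt_minimal
    (S := {x : D.Path | (∀ n, N < n → x.edge n = y.edge n) ∧ x.Lt y})
    ((finite_cofinal y N).subset fun _ h => h.1)
    ⟨x₀, hx₀', N, by rw [hx₀]; exact he, hx₀'⟩).2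
  refine ⟨x, hxy, fun z hxz => ?_⟩
  obtain ⟨K, hK⟩ := hxz.cofinal
  obtain ⟨L, hL⟩ := hxy.cofinal
  rcases Path.lt_trichotomy_of_cofinal (x := y) (y := z) (max K L) (fun n hn =>
      (hL n (le_of_max_le_right hn)).symm.trans (hK n (le_of_max_le_left hn))) with h | h | h
  · exact Or.inr h
  · exact Or.inl h
  · exfalso
    obtain ⟨M, hM, hM'⟩ := id h
    rcases lt_trichotomy M N with hl | rfl | hl
    · exact (hmin M hl).not_lt hM
    · exact hmax z ⟨hM', h⟩ hxz
    · exact Path.Lt.irrefl _ (hxz.trans ⟨M, by rw [hx M hl]; exact hM, fun n hn =>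
        (hM' n hn).trans (hx n (hl.trans hn)).symm⟩)

open Classical in
/-- The Vershik map as a function: a nonmaximal path is mapped to its successor, the maximal path
to the minimal path. -/
noncomputable def vershikFun (hD : D.ProperlyOrdered) (x : D.Path) : D.Path :=
  if hx : x.IsMaximal then hD.1.choose else (exists_isSuccessor x hx).choose

theorem vershikFun_of_isMaximal (hD : D.ProperlyOrdered) {x : D.Path} (hx : x.IsMaximal) :
    (vershikFun hD x).IsMinimal := by
  rw [vershikFun, dif_pos hx]
  exact hD.1.choose_spec.1

theorem vershikFun_isSuccessor (hD : D.ProperlyOrdered) {x : D.Path} (hx : ¬ x.IsMaximal) :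
    x.IsSuccessor (vershikFun hD x) := by
  rw [vershikFun, dif_neg hx]
  exact (exists_isSuccessor x hx).choose_spec

theorem Path.Lt.not_isMinimal {x y : D.Path} (h : x.Lt y) : ¬ y.IsMinimal := by
  obtain ⟨N, hN, _⟩ := h
  exact fun hy => (hy N).not_lt hN

theorem Path.Lt.not_isMaximal {x y : D.Path} (h : x.Lt y) : ¬ x.IsMaximal := by
  obtain ⟨N, hN, _⟩ := h
  exact fun hx => (hx N).not_lt hN

theorem Path.IsSuccessor.unique {x y z : D.Path} (hy : x.IsSuccessor y) (hz : x.IsSuccessor z) :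
    y = z := by
  rcases hy.2 z hz.1 with h | h
  · exact h
  · rcases hz.2 y hy.1 with h' | h'
    · exact h'.symm
    · exact absurd (h.trans h') (Path.Lt.irrefl _)

theorem vershikFun_bijective (hD : D.ProperlyOrdered) : Function.Bijective (vershikFun hD) := by
  constructor
  · intro x x' h
    by_cases hx : x.IsMaximal <;> by_cases hx' : x'.IsMaximal
    · exact hD.2.unique hx hx'
    · exact absurd (h ▸ vershikFun_of_isMaximal hD hx)
        (vershikFun_isSuccessor hD hx').1.not_isMinimal
    · exact absurd (h ▸ vershikFun_of_isMaximal hD hx')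
        (vershikFun_isSuccessor hD hx).1.not_isMinimal
    · have h1 := vershikFun_isSuccessor hD hx
      have h2 := vershikFun_isSuccessor hD hx'
      rw [← h] at h2
      obtain ⟨K, hK⟩ := h1.1.cofinal
      obtain ⟨L, hL⟩ := h2.1.cofinal
      rcases Path.lt_trichotomy_of_cofinal (x := x) (y := x') (max K L) (fun n hn =>
          (hK n (le_of_max_le_left hn)).trans (hL n (le_of_max_le_right hn)).symm)
        with h' | h' | h'
      · exfalso
        rcases h1.2 x' h' with h3 | h3
        · exact Path.Lt.irrefl x' (by simpa [h3] using h2.1)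
        · exact Path.Lt.irrefl _ (h3.trans h2.1)
      · exact h'
      · exfalso
        rcases h2.2 x h' with h3 | h3
        · exact Path.Lt.irrefl x (by simpa [h3] using h1.1)
        · exact Path.Lt.irrefl _ (h3.trans h1.1)
  · intro y
    by_cases hy : y.IsMinimal
    · obtain ⟨x, hx, _⟩ := hD.2
      exact ⟨x, hD.1.unique (vershikFun_of_isMaximal hD hx) hy⟩
    · obtain ⟨x, hx⟩ := exists_isSuccessor_of y hy
      exact ⟨x, (vershikFun_isSuccessor hD hx.1.not_isMaximal).unique hx⟩

end VershikMap

end OrderedBratteliDiagram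

/-- A (simple, properly ordered) Bratteli-Vershik system, given by its diagram; as usual the path
space is assumed to be homeomorphic to the Cantor set. -/
structure BVSystem extends OrderedBratteliDiagram where
  properlyOrdered : toOrderedBratteliDiagram.ProperlyOrdered
  simple : toOrderedBratteliDiagram.Simple
  homeomorph_cantorSet : Nonempty (toOrderedBratteliDiagram.Path ≃ₜ cantorSet)

namespace BVSystem

/-- The phase space of the system. -/
abbrev Path (X : BVSystem) : Type := X.toOrderedBratteliDiagram.Path

/-- The Vershik map: a nonmaximal path is mapped to its successor, the unique maximal path is
mapped to the unique minimal path. -/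
noncomputable def T (X : BVSystem) : Equiv.Perm X.Path :=
  Equiv.ofBijective _ (OrderedBratteliDiagram.vershikFun_bijective X.properlyOrdered)

/-- The `k`-coding of `x`: the doubly infinite sequence whose `n`-th entry is the initial segment
of `T ^ n x` from the root to level `k`. -/
noncomputable def coding (X : BVSystem) (k : ℕ) (x : X.Path) : ℤ → ∀ i : Fin k, X.E i :=
  fun n i => ((X.T ^ n) x).edge i

/-- For every `k ≥ 1` there is a pair of distinct paths with the same `k`-coding. -/
def Nonexpansive (X : BVSystem) : Prop :=
  ∀ k, 1 ≤ k → ∃ x x' : X.Path, x ≠ x' ∧ X.coding k x = X.coding k x'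

/-- `x, x'` is a pair of distinct paths of depth `k`: they have the same `k`-coding but not the same
`(k + 1)`-coding. -/
def IsDepthPair (X : BVSystem) (k : ℕ) (x x' : X.Path) : Prop :=
  x ≠ x' ∧ X.coding k x = X.coding k x' ∧ X.coding (k + 1) x ≠ X.coding (k + 1) x'

/-- The paths `x` and `x'` have a common `j` cut: at some time both orbits are minimal into
level `j`. -/
def HasCut (X : BVSystem) (j : ℕ) (x x' : X.Path) : Prop :=
  ∃ m : ℤ, ((X.T ^ m) x).MinimalInto j ∧ ((X.T ^ m) x').MinimalInto j

/-- Two systems are conjugate if there is an equivariant homeomorphism between their path spaces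
that maps the minimal path to the minimal path. -/
def Conjugate (X Y : BVSystem) : Prop :=
  ∃ h : X.Path ≃ₜ Y.Path, (∀ x, h (X.T x) = Y.T (h x)) ∧
    ∀ x : X.Path, x.IsMinimal → (h x).IsMinimal

/-- The class `NE` of nonexpansive systems. -/
def NE : Set BVSystem := {X | X.Nonexpansive}

/-- The class `W` of well timed (nonexpansive) systems: for all `k ≥ 1` and `j > k` there is a
depth `k` pair with a `j` cut. -/
def W : Set BVSystem :=
  {X | X.Nonexpansive ∧
    ∀ k, 1 ≤ k → ∀ j, k < j → ∃ x x' : X.Path, X.IsDepthPair k x x' ∧ X.HasCut j x x'}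

/-- The class `U` of untimed (nonexpansive) systems: for all `k ≥ 1` there is `j > k` such that no
depth `k` pair has a `j` cut. -/
def U : Set BVSystem :=
  {X | X.Nonexpansive ∧
    ∀ k, 1 ≤ k → ∃ j, k < j ∧ ∀ x x' : X.Path, X.IsDepthPair k x x' → ¬ X.HasCut j x x'}

/-- For a class `S` of systems, the class `C S` of the systems conjugate to a system in `S`. -/
def C (S : Set BVSystem) : Set BVSystem := {X | ∃ Y ∈ S, X.Conjugate Y}

end BVSystem

/-!
Every class in the theorem is understood through telescoping, that is, passing to a subsequence
`0 = l 0 < l 1 < l 2 < ⋯` of the levels.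

The path space of the telescoping is that of the original diagram, with the same topology, the same
order and hence the same Vershik map (`telescopeHomeomorph`, `telescopePath_lt_iff`,
`telescopePath_vershikFun`). So telescoping does not change the conjugacy class, while the
`k`-coding becomes the `l k`-coding and a `j` cut becomes an `l j` cut (`coding_telescopePath`,
`hasCut_telescopePath`). For a nonexpansive system, call a depth `k ≥ 1` unbounded if for every
`j > k` it has a pair with a `j` cut. If only finitely many depths are unbounded, telescoping away
the initial levels leaves an untimed system (`Nonexpansive.mem_C_U`). Otherwise, telescoping to
unbounded depths produces a well timed system: a pair that has depth `l i` before the telescoping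
has depth `i` afterwards (`Nonexpansive.mem_C_W`).

Conversely, by compactness a conjugacy preserves codings up to a change of levels
(`exists_coding_eq_of_coding_eq`), and it maps paths that are minimal into a high level to paths
that are minimal into a prescribed level, because it preserves the minimal path
(`exists_hasCut_of_hasCut`). The first fact gives the invariance of nonexpansiveness. Together they
show that a well timed system is never conjugate to an untimed one: the pairs of a fixed large depth
in the former have images of finitely many positive depths in the latter, where cuts are bounded,
but their own cuts are not bounded (`not_conjugate_of_mem_W_of_mem_U`).
-/

namespace OrderedBratteliDiagram

variable {D : OrderedBratteliDiagram}

/-! ### Infinite paths and their segments -/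

/-- The vertex at level `n` through which the path `x` passes. -/
def Path.vertex (x : D.Path) (n : ℕ) : D.V n := D.source (x.edge n)

theorem Path.target_edge (x : D.Path) (n : ℕ) : D.target (x.edge n) = x.vertex (n + 1) := x.2 n

theorem Path.vertex_succ_congr {x y : D.Path} {n : ℕ} (h : x.edge n = y.edge n) :
    x.vertex (n + 1) = y.vertex (n + 1) := by
  rw [← x.target_edge, ← y.target_edge, h]

/-- Every edge lies on an infinite path from the root. -/
theorem exists_path_edge {m : ℕ} (e : D.E m) : ∃ x : D.Path, x.edge m = e := by
  choose F hF using fun (n : ℕ) (e : D.E n) => D.exists_outgoing (D.target e)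
  let G : ∀ i, m ≤ i → D.E i := fun i hi =>
    Nat.leRec (motive := fun i _ => D.E i) e (fun i _ e => F i e) hi
  let g : ∀ i, D.E i := fun i => if h : m ≤ i then G i h else (D.nonempty_E i).some
  obtain ⟨x, hx⟩ := exists_path_tail m g (by
    intro i hi
    have h1 : g i = G i hi := dif_pos hi
    have h2 : g (i + 1) = G (i + 1) (hi.trans i.le_succ) := dif_pos _
    have h3 : G (i + 1) (hi.trans i.le_succ) = F i (G i hi) :=
      Nat.leRec_succ (motive := fun i _ => D.E i) _ _ hi
    rw [h1, h2, h3, hF])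
  refine ⟨x, ?_⟩
  rw [hx m le_rfl, show g m = G m le_rfl from dif_pos _]
  exact Nat.leRec_self (motive := fun i _ => D.E i) _ _

theorem exists_path_vertex {n : ℕ} (v : D.V n) : ∃ x : D.Path, x.vertex n = v := by
  obtain ⟨e, rfl⟩ := D.exists_outgoing v
  obtain ⟨x, rfl⟩ := exists_path_edge e
  exact ⟨x, rfl⟩

/-- Paths through a common vertex can be cut there and recombined. -/
theorem exists_path_splice (x y : D.Path) {n : ℕ} (h : x.vertex n = y.vertex n) :
    ∃ z : D.Path, (∀ i, i < n → z.edge i = x.edge i) ∧ ∀ i, n ≤ i → z.edge i = y.edge i := by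
  refine ⟨⟨fun i => if i < n then x.edge i else y.edge i, fun i => ?_⟩,
    fun i hi => if_pos hi, fun i hi => if_neg hi.not_gt⟩
  beta_reduce
  rcases lt_trichotomy (i + 1) n with hi | rfl | hi
  · rw [if_pos (by omega), if_pos hi]
    exact x.2 i
  · rw [if_pos (by omega), if_neg (by omega)]
    exact (x.2 i).trans h
  · rw [if_neg (by omega), if_neg (by omega)]
    exact y.2 i

/-- The finite paths from level `a` to level `b`, as families of edges. Since every finite path
extends to an infinite path from the root, they are encoded as restrictions of infinite paths. -/
def Segment (D : OrderedBratteliDiagram) (a b : ℕ) : Type :=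
  Set.range fun (x : D.Path) (n : Set.Ico a b) => x.edge n

/-- The part of the path `x` from level `a` to level `b`. -/
def Path.segment (x : D.Path) (a b : ℕ) : D.Segment a b := ⟨_, x, rfl⟩

theorem Segment.exists_eq_segment {a b : ℕ} (e : D.Segment a b) :
    ∃ x : D.Path, x.segment a b = e := by
  obtain ⟨_, x, rfl⟩ := e
  exact ⟨x, rfl⟩

theorem Path.segment_eq_iff {x y : D.Path} {a b : ℕ} :
    x.segment a b = y.segment a b ↔ ∀ n, a ≤ n → n < b → x.edge n = y.edge n := by
  refine ⟨fun h n h1 h2 => congrFun (congrArg Subtype.val h) ⟨n, h1, h2⟩, fun h => ?_⟩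
  exact Subtype.ext (funext fun n => h n n.2.1 n.2.2)

/-- An infinite path that extends the given finite path. -/
noncomputable def Segment.path {a b : ℕ} (e : D.Segment a b) : D.Path :=
  e.exists_eq_segment.choose

theorem Segment.segment_path {a b : ℕ} (e : D.Segment a b) : e.path.segment a b = e :=
  e.exists_eq_segment.choose_spec

theorem Path.vertex_eq_of_segment_eq {x y : D.Path} {a b : ℕ} (hab : a < b)
    (h : x.segment a b = y.segment a b) :
    x.vertex a = y.vertex a ∧ x.vertex b = y.vertex b := by
  rw [segment_eq_iff] at h
  obtain ⟨c, rfl⟩ : ∃ c, b = c + 1 := ⟨b - 1, by omega⟩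
  exact ⟨congrArg D.source (h a le_rfl hab), vertex_succ_congr (h c (by omega) (by omega))⟩

theorem Path.vertex_path_segment (x : D.Path) {a b : ℕ} (hab : a < b) :
    (x.segment a b).path.vertex a = x.vertex a ∧ (x.segment a b).path.vertex b = x.vertex b :=
  vertex_eq_of_segment_eq hab (Segment.segment_path _)

/-- The order of edges in a telescoping: finite paths are compared at the last level where they
differ. -/
instance Segment.instPartialOrder (a b : ℕ) : PartialOrder (D.Segment a b) where
  le e f := e = f ∨ ∃ N, e.1 N < f.1 N ∧ ∀ n, N < n → e.1 n = f.1 n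
  le_refl _ := Or.inl rfl
  le_trans := by
    rintro e f g (rfl | ⟨N, hN, hN'⟩) (rfl | ⟨M, hM, hM'⟩)
    · exact Or.inl rfl
    · exact Or.inr ⟨M, hM, hM'⟩
    · exact Or.inr ⟨N, hN, hN'⟩
    · rcases lt_trichotomy N M with hl | rfl | hl
      · exact Or.inr ⟨M, by rw [hN' M hl]; exact hM,
          fun n hn => (hN' n (hl.trans hn)).trans (hM' n hn)⟩
      · exact Or.inr ⟨N, hN.trans hM, fun n hn => (hN' n hn).trans (hM' n hn)⟩
      · exact Or.inr ⟨N, by rw [← hM' N hl]; exact hN,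
          fun n hn => (hN' n hn).trans (hM' n (hl.trans hn))⟩
  le_antisymm := by
    rintro e f (rfl | ⟨N, hN, hN'⟩) (h | ⟨M, hM, hM'⟩)
    · rfl
    · rfl
    · exact h.symm
    · rcases lt_trichotomy N M with hl | rfl | hl
      · exact absurd (hN' M hl) hM.ne'
      · exact absurd hM hN.not_gt
      · exact absurd (hM' N hl) hN.ne'

theorem Path.segment_lt_iff {x y : D.Path} {a b : ℕ} :
    x.segment a b < y.segment a b ↔ ∃ N, a ≤ N ∧ N < b ∧ x.edge N < y.edge N ∧
      ∀ n, N < n → n < b → x.edge n = y.edge n := by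
  constructor
  · intro h
    rcases h.le with h' | ⟨N, hN, hN'⟩
    · exact absurd h' h.ne
    · exact ⟨N, N.2.1, N.2.2, hN, fun n h1 h2 => hN' ⟨n, N.2.1.trans h1.le, h2⟩ h1⟩
  · rintro ⟨N, h1, h2, hN, hN'⟩
    refine lt_of_le_of_ne (Or.inr ⟨⟨N, h1, h2⟩, hN, fun n hn => hN' n hn n.2.2⟩) fun h => ?_
    exact hN.ne (segment_eq_iff.1 h N h1 h2)

theorem Path.isMin_segment_iff {x : D.Path} {a b : ℕ} :
    IsMin (x.segment a b) ↔ ∀ n, a ≤ n → n < b → IsMin (x.edge n) := by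
  simp only [isMin_iff_forall_not_lt]
  constructor
  · intro h n h1 h2 e he
    obtain ⟨y, rfl, hy'⟩ := exists_path_change x n e ((D.comparable_iff _ _).1 (Or.inl he.le))
    exact h (y.segment a b) (segment_lt_iff.2 ⟨n, h1, h2, he, fun i hi _ => hy' i hi⟩)
  · intro h f hf
    obtain ⟨y, rfl⟩ := f.exists_eq_segment
    obtain ⟨N, h1, h2, hN, -⟩ := segment_lt_iff.1 hf
    exact h N h1 h2 _ hN

theorem Path.isMax_segment_iff {x : D.Path} {a b : ℕ} :
    IsMax (x.segment a b) ↔ ∀ n, a ≤ n → n < b → IsMax (x.edge n) := by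
  simp only [isMax_iff_forall_not_lt]
  constructor
  · intro h n h1 h2 e he
    obtain ⟨y, rfl, hy'⟩ := exists_path_change x n e ((D.comparable_iff _ _).1 (Or.inr he.le))
    exact h (y.segment a b) (segment_lt_iff.2 ⟨n, h1, h2, he, fun i hi _ => (hy' i hi).symm⟩)
  · intro h f hf
    obtain ⟨y, rfl⟩ := f.exists_eq_segment
    obtain ⟨N, h1, h2, hN, -⟩ := segment_lt_iff.1 hf
    exact h N h1 h2 _ hN

theorem Path.vertex_eq_of_segment_lt {x y : D.Path} {a b : ℕ}
    (h : x.segment a b < y.segment a b) : x.vertex b = y.vertex b := by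
  obtain ⟨N, -, h2, hN, hN'⟩ := segment_lt_iff.1 h
  obtain ⟨c, rfl⟩ : ∃ c, b = c + 1 := ⟨b - 1, by omega⟩
  rcases (Nat.lt_succ_iff.1 h2).eq_or_lt with rfl | hc
  · rw [← target_edge, ← target_edge]
    exact (D.comparable_iff _ _).1 (Or.inl hN.le)
  · exact vertex_succ_congr (hN' c hc c.lt_succ_self)

theorem Segment.comparable_iff {a b : ℕ} (e f : D.Segment a b) :
    (e ≤ f ∨ f ≤ e) ↔ e.path.vertex b = f.path.vertex b := by
  constructor
  · rintro (h | h)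
    all_goals
      rcases h.eq_or_lt with rfl | h
      · rfl
      · rw [← e.segment_path, ← f.segment_path] at h
        first
          | exact Path.vertex_eq_of_segment_lt h
          | exact (Path.vertex_eq_of_segment_lt h).symm
  · intro h
    -- Continue both segments by the same tail, so that the resulting paths are comparable.
    obtain ⟨z, hz, hz'⟩ := exists_path_splice _ _ h
    have he : z.segment a b = e := by
      rw [← e.segment_path]
      exact Path.segment_eq_iff.2 fun n _ hn => hz n hn
    have key : ∀ x y : D.Path, (∀ n, b ≤ n → x.edge n = y.edge n) → x.Lt y →
        x.segment a b ≤ y.segment a b := by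
      rintro x y hxy ⟨N, hN, hN'⟩
      by_cases haN : a ≤ N
      · refine (Path.segment_lt_iff.2 ⟨N, haN, ?_, hN, fun n hn _ => hN' n hn⟩).le
        by_contra hb
        exact hN.ne (hxy N (not_lt.1 hb))
      · exact (Path.segment_eq_iff.2 fun n hn _ => hN' n (by omega)).le
    rw [← he, ← f.segment_path]
    rcases Path.lt_trichotomy_of_cofinal b hz' with h | h | h
    · exact Or.inl (key _ _ hz' h)
    · exact Or.inl (by rw [h])
    · exact Or.inr (key _ _ (fun n hn => (hz' n hn).symm) h)

/-! ### Telescoping -/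

/-- The telescoping of the diagram `D` to the levels `l 0 = 0 < l 1 < l 2 < ⋯`. -/
noncomputable def telescope (D : OrderedBratteliDiagram) (l : ℕ → ℕ) (hl : StrictMono l)
    (h0 : l 0 = 0) : OrderedBratteliDiagram where
  V i := D.V (l i)
  E i := D.Segment (l i) (l (i + 1))
  finite_V i := D.finite_V _
  nonempty_V i := D.nonempty_V _
  subsingleton_root := by rw [h0]; exact D.subsingleton_root
  finite_E i := by
    have : ∀ n, Finite (D.E n) := D.finite_E
    exact inferInstanceAs
      (Finite (Set.range fun (x : D.Path) (n : Set.Ico (l i) (l (i + 1))) => x.edge n))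
  nonempty_E i := by
    obtain ⟨x, -⟩ := exists_path_edge (D.nonempty_E 0).some
    exact ⟨x.segment _ _⟩
  source {i} e := e.path.vertex (l i)
  target {i} e := e.path.vertex (l (i + 1))
  exists_outgoing {i} v := by
    obtain ⟨x, rfl⟩ := exists_path_vertex v
    exact ⟨x.segment _ _, (x.vertex_path_segment (hl i.lt_succ_self)).1⟩
  exists_incoming {i} v := by
    obtain ⟨x, rfl⟩ := exists_path_vertex v
    exact ⟨x.segment _ _, (x.vertex_path_segment (hl i.lt_succ_self)).2⟩
  edgeOrder i := Segment.instPartialOrder _ _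
  comparable_iff {i} e f := Segment.comparable_iff e f

section Telescope

variable (l : ℕ → ℕ) (hl : StrictMono l) (h0 : l 0 = 0)

/-- The path of the telescoping that consists of the segments of `x`. -/
noncomputable def telescopePath (x : D.Path) : (D.telescope l hl h0).Path :=
  ⟨fun i => x.segment (l i) (l (i + 1)), fun i =>
    (x.vertex_path_segment (hl i.lt_succ_self)).2.trans
      (x.vertex_path_segment (hl (i + 1).lt_succ_self)).1.symm⟩

variable {l} {hl} {h0}

theorem telescopePath_vertex (x : D.Path) (i : ℕ) :
    (telescopePath l hl h0 x).vertex i = x.vertex (l i) :=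
  (x.vertex_path_segment (hl i.lt_succ_self)).1

theorem exists_mem_block (hl : StrictMono l) (h0 : l 0 = 0) (n : ℕ) :
    ∃ i, l i ≤ n ∧ n < l (i + 1) := by
  induction n with
  | zero => exact ⟨0, h0.le, (Nat.zero_le _).trans_lt (hl Nat.zero_lt_one)⟩
  | succ n ih =>
    obtain ⟨i, h1, h2⟩ := ih
    rcases Nat.lt_or_ge (n + 1) (l (i + 1)) with h | h
    · exact ⟨i, by omega, h⟩
    · exact ⟨i + 1, h, lt_of_le_of_lt (Nat.succ_le_of_lt h2) (hl (i + 1).lt_succ_self)⟩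

theorem block_unique (hl : StrictMono l) {i j n : ℕ} (hi : l i ≤ n ∧ n < l (i + 1))
    (hj : l j ≤ n ∧ n < l (j + 1)) : i = j := by
  have h1 := hl.lt_iff_lt.1 (hi.1.trans_lt hj.2)
  have h2 := hl.lt_iff_lt.1 (hj.1.trans_lt hi.2)
  omega

theorem telescopePath_injective :
    Function.Injective (telescopePath (D := D) l hl h0) := by
  intro x y h
  refine Path.ext' fun n => ?_
  obtain ⟨i, h1, h2⟩ := exists_mem_block hl h0 n
  exact Path.segment_eq_iff.1 (congrArg (fun z => Path.edge z i) h) n h1 h2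

theorem telescopePath_surjective :
    Function.Surjective (telescopePath (D := D) l hl h0) := by
  intro y
  have hrep : ∀ i, ∃ z : D.Path, z.segment (l i) (l (i + 1)) = y.edge i :=
    fun i => Segment.exists_eq_segment (y.edge i)
  choose z hz using hrep
  have hv : ∀ i, (z i).vertex (l (i + 1)) = (z (i + 1)).vertex (l (i + 1)) := by
    intro i
    have := y.target_edge i
    change Path.vertex (Segment.path (y.edge i)) _ = Path.vertex (Segment.path (y.edge (i + 1))) _
      at this
    rw [← hz, ← hz] at this
    rwa [((z i).vertex_path_segment (hl i.lt_succ_self)).2,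
      ((z (i + 1)).vertex_path_segment (hl (i + 1).lt_succ_self)).1] at this
  -- The edge at level `n` comes from the representative of the block `[l i, l (i + 1))` of `n`.
  choose idx hidx using exists_mem_block hl h0
  have hx : ∀ i n, l i ≤ n → n < l (i + 1) → (z (idx n)).edge n = (z i).edge n := by
    intro i n h1 h2
    rw [block_unique hl (hidx n) ⟨h1, h2⟩]
  refine ⟨⟨fun n => (z (idx n)).edge n, fun n => ?_⟩, Path.ext' fun i => ?_⟩
  · obtain ⟨h1, h2⟩ := hidx n
    rcases (Nat.succ_le_of_lt h2).lt_or_eq with h | h <;> beta_reduce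
    · rw [hx (idx n) (n + 1) (by omega) h]
      exact (z (idx n)).2 n
    · have h' : n + 1 = l (idx n + 1) := h
      rw [hx (idx n + 1) (n + 1) h'.ge (h'.trans_lt (hl (idx n + 1).lt_succ_self)),
        Path.target_edge, h']
      exact hv (idx n)
  · rw [← hz]
    exact Path.segment_eq_iff.2 fun n h1 h2 => hx i n h1 h2

theorem Path.continuous_iff {Y : Type*} [TopologicalSpace Y] {f : Y → D.Path} :
    Continuous f ↔ ∀ n, Continuous fun y => (f y).edge n :=
  (Topology.IsInducing.subtypeVal.continuous_iff).trans continuous_pi_iff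

theorem Path.continuous_edge (n : ℕ) : Continuous fun x : D.Path => x.edge n :=
  continuous_iff.1 continuous_id n

variable (D l hl h0) in
/-- A diagram and its telescoping have the same paths. -/
noncomputable def telescopeEquiv : D.Path ≃ (D.telescope l hl h0).Path :=
  Equiv.ofBijective (telescopePath l hl h0) ⟨telescopePath_injective, telescopePath_surjective⟩

theorem telescopeEquiv_symm_edge (y : (D.telescope l hl h0).Path) {i n : ℕ}
    (hn : n ∈ Set.Ico (l i) (l (i + 1))) :
    ((telescopeEquiv D l hl h0).symm y).edge n =
      (y.edge i : D.Segment (l i) (l (i + 1))).1 ⟨n, hn⟩ := by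
  obtain ⟨x, rfl⟩ := (telescopeEquiv D l hl h0).surjective y
  rw [Equiv.symm_apply_apply]
  rfl

theorem continuous_telescopePath : Continuous (telescopePath (D := D) l hl h0) := by
  refine Path.continuous_iff.2 fun i => continuous_discrete_rng.2 fun e => ?_
  obtain ⟨x, hx⟩ := Segment.exists_eq_segment e
  have : (fun y : D.Path => (telescopePath l hl h0 y).edge i) ⁻¹' {e} =
      ⋂ n ∈ Set.Ico (l i) (l (i + 1)), (fun y : D.Path => y.edge n) ⁻¹' {x.edge n} := by
    ext y
    simp only [Set.mem_preimage, Set.mem_singleton_iff, Set.mem_iInter, Set.mem_Ico, and_imp]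
    rw [← hx]
    exact Path.segment_eq_iff
  rw [this]
  exact (Set.finite_Ico _ _).isOpen_biInter fun n _ =>
    (isOpen_discrete _).preimage (Path.continuous_edge n)

variable (D l hl h0) in
/-- The paths of a diagram and of its telescoping carry the same topology. -/
noncomputable def telescopeHomeomorph : D.Path ≃ₜ (D.telescope l hl h0).Path where
  toEquiv := telescopeEquiv D l hl h0
  continuous_toFun := continuous_telescopePath
  continuous_invFun := by
    refine Path.continuous_iff.2 fun n => ?_
    obtain ⟨i, hi⟩ := exists_mem_block hl h0 n
    have hc : Continuous fun e : (D.telescope l hl h0).E i =>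
        Subtype.val (p := fun z => z ∈ Set.range fun (x : D.Path)
          (n : Set.Ico (l i) (l (i + 1))) => x.edge n) e ⟨n, hi⟩ :=
      continuous_of_discreteTopology
    exact (hc.comp (Path.continuous_edge i)).congr fun y => (telescopeEquiv_symm_edge y hi).symm

theorem Path.Lt.telescopePath {x y : D.Path} (h : x.Lt y) :
    (telescopePath l hl h0 x).Lt (telescopePath l hl h0 y) := by
  obtain ⟨N, hN, hN'⟩ := h
  obtain ⟨i, h1, h2⟩ := exists_mem_block hl h0 N
  refine ⟨i, Path.segment_lt_iff.2 ⟨N, h1, h2, hN, fun n hn _ => hN' n hn⟩, fun j hj => ?_⟩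
  refine Path.segment_eq_iff.2 fun n hn _ => hN' n ?_
  exact h2.trans_le ((hl.monotone (Nat.succ_le_of_lt hj)).trans hn)

theorem telescopePath_lt_iff {x y : D.Path} :
    (telescopePath l hl h0 x).Lt (telescopePath l hl h0 y) ↔ x.Lt y := by
  refine ⟨fun h => ?_, Path.Lt.telescopePath⟩
  obtain ⟨N, hN⟩ := h.cofinal
  have hc : ∀ n, l N ≤ n → x.edge n = y.edge n := by
    intro n hn
    obtain ⟨i, h1, h2⟩ := exists_mem_block hl h0 n
    have hi : N ≤ i := Nat.lt_succ_iff.1 (hl.lt_iff_lt.1 (hn.trans_lt h2))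
    exact Path.segment_eq_iff.1 (hN i hi) n h1 h2
  rcases Path.lt_trichotomy_of_cofinal (l N) hc with h' | rfl | h'
  · exact h'
  · exact absurd h (Path.Lt.irrefl _)
  · exact absurd (h.trans h'.telescopePath) (Path.Lt.irrefl _)

theorem minimalInto_telescopePath {x : D.Path} {j : ℕ} :
    (telescopePath l hl h0 x).MinimalInto j ↔ x.MinimalInto (l j) := by
  constructor
  · intro h n hn
    obtain ⟨i, h1, h2⟩ := exists_mem_block hl h0 n
    exact Path.isMin_segment_iff.1 (h i (hl.lt_iff_lt.1 (h1.trans_lt hn))) n h1 h2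
  · intro h i hi
    exact Path.isMin_segment_iff.2 fun n _ hn =>
      h n (hn.trans_le (hl.monotone (Nat.succ_le_of_lt hi)))

theorem isMinimal_telescopePath {x : D.Path} :
    (telescopePath l hl h0 x).IsMinimal ↔ x.IsMinimal := by
  constructor
  · intro h n
    obtain ⟨i, h1, h2⟩ := exists_mem_block hl h0 n
    exact Path.isMin_segment_iff.1 (h i) n h1 h2
  · exact fun h i => Path.isMin_segment_iff.2 fun n _ _ => h n

theorem isMaximal_telescopePath {x : D.Path} :
    (telescopePath l hl h0 x).IsMaximal ↔ x.IsMaximal := by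
  constructor
  · intro h n
    obtain ⟨i, h1, h2⟩ := exists_mem_block hl h0 n
    exact Path.isMax_segment_iff.1 (h i) n h1 h2
  · exact fun h i => Path.isMax_segment_iff.2 fun n _ _ => h n

theorem ProperlyOrdered.telescope (h : D.ProperlyOrdered) :
    (D.telescope l hl h0).ProperlyOrdered := by
  obtain ⟨⟨x, hx, hx'⟩, y, hy, hy'⟩ := h
  refine ⟨⟨telescopePath l hl h0 x, isMinimal_telescopePath.2 hx, fun z hz => ?_⟩,
    ⟨telescopePath l hl h0 y, isMaximal_telescopePath.2 hy, fun z hz => ?_⟩⟩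
  all_goals obtain ⟨w, rfl⟩ := telescopePath_surjective z
  · rw [hx' w (isMinimal_telescopePath.1 hz)]
  · rw [hy' w (isMaximal_telescopePath.1 hz)]

theorem Path.IsSuccessor.telescopePath {x y : D.Path} (h : x.IsSuccessor y) :
    (telescopePath l hl h0 x).IsSuccessor (telescopePath l hl h0 y) := by
  refine ⟨h.1.telescopePath, fun z hz => ?_⟩
  obtain ⟨w, rfl⟩ := telescopePath_surjective z
  rcases h.2 w (telescopePath_lt_iff.1 hz) with rfl | h'
  · exact Or.inl rfl
  · exact Or.inr h'.telescopePath

theorem telescopePath_vershikFun (h : D.ProperlyOrdered)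
    (h' : (D.telescope l hl h0).ProperlyOrdered) (x : D.Path) :
    telescopePath l hl h0 (vershikFun h x) = vershikFun h' (telescopePath l hl h0 x) := by
  by_cases hx : x.IsMaximal
  · exact h'.1.unique (isMinimal_telescopePath.2 (vershikFun_of_isMaximal h hx))
      (vershikFun_of_isMaximal h' (isMaximal_telescopePath.2 hx))
  · exact (vershikFun_isSuccessor h hx).telescopePath.unique
      (vershikFun_isSuccessor h' fun hm => hx (isMaximal_telescopePath.1 hm))

end Telescope

/-! ### Simplicity of telescopings -/

theorem reaches_vertex (x : D.Path) {m n : ℕ} (h : m ≤ n) :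
    D.Reaches (x.vertex m) (x.vertex n) := by
  induction n, h using Nat.le_induction with
  | base => exact Reaches.refl
  | succ n _ ih => exact x.target_edge n ▸ Reaches.step (x.edge n) ih

theorem Reaches.exists_path {m n : ℕ} {v : D.V m} {w : D.V n} (h : D.Reaches v w) :
    m ≤ n ∧ ∃ x : D.Path, x.vertex m = v ∧ x.vertex n = w := by
  induction h with
  | refl =>
    obtain ⟨x, hx⟩ := exists_path_vertex v
    exact ⟨le_rfl, x, hx, hx⟩
  | @step n e _ ih =>
    obtain ⟨hmn, x, hx, hx'⟩ := ih
    obtain ⟨y, rfl⟩ := exists_path_edge e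
    obtain ⟨z, hz, hz'⟩ := exists_path_splice x y hx'
    refine ⟨hmn.trans n.le_succ, z, ?_, ?_⟩
    · rcases hmn.eq_or_lt with rfl | h
      · rw [← hx, hx']
        exact congrArg D.source (hz' m le_rfl)
      · rw [← hx]
        exact congrArg D.source (hz m h)
    · rw [← z.target_edge, hz' n le_rfl]

theorem Reaches.trans {m n k : ℕ} {u : D.V m} {v : D.V n} {w : D.V k} (h : D.Reaches u v)
    (h' : D.Reaches v w) : D.Reaches u w := by
  induction h' with
  | refl => exact h
  | step e _ ih => exact Reaches.step e ih

theorem Simple.exists_forall_reaches (h : D.Simple) (a : ℕ) :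
    ∃ b, a < b ∧ ∀ c, b ≤ c → ∀ (v : D.V a) (w : D.V c), D.Reaches v w := by
  obtain ⟨s, -, hs, hr⟩ := h
  refine ⟨s (a + 1), (Nat.lt_succ_self a).trans_le hs.le_apply, fun c hc v w => ?_⟩
  obtain ⟨x, rfl⟩ := exists_path_vertex v
  obtain ⟨y, rfl⟩ := exists_path_vertex w
  exact ((reaches_vertex x hs.le_apply).trans (hr a _ (y.vertex _))).trans (reaches_vertex y hc)

theorem Simple.telescope {l : ℕ → ℕ} {hl : StrictMono l} {h0 : l 0 = 0} (h : D.Simple) :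
    (D.telescope l hl h0).Simple := by
  choose b hb hb' using h.exists_forall_reaches
  -- The next level is chosen so far down that everything is connected to the current level.
  let s : ℕ → ℕ := fun i => Nat.rec 0 (fun _ a => max (a + 1) (b (l a))) i
  have hs : ∀ i, s (i + 1) = max (s i + 1) (b (l (s i))) := fun i => rfl
  refine ⟨s, rfl, strictMono_nat_of_lt_succ fun i => by rw [hs]; omega, fun i v w => ?_⟩
  have hle : b (l (s i)) ≤ l (s (i + 1)) :=
    ((le_max_right _ _).trans (hs i).ge).trans hl.le_apply
  obtain ⟨-, x, rfl, rfl⟩ := (hb' (l (s i)) (l (s (i + 1))) hle v w).exists_path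
  have := reaches_vertex (telescopePath l hl h0 x)
    (show s i ≤ s (i + 1) by rw [hs]; omega)
  rwa [telescopePath_vertex, telescopePath_vertex] at this

end OrderedBratteliDiagram

namespace BVSystem

open OrderedBratteliDiagram

/-! ### Telescoping of systems -/

/-- The telescoping of a system to the levels `l 0 = 0 < l 1 < l 2 < ⋯`. -/
noncomputable def telescope (X : BVSystem) (l : ℕ → ℕ) (hl : StrictMono l) (h0 : l 0 = 0) :
    BVSystem where
  toOrderedBratteliDiagram := X.toOrderedBratteliDiagram.telescope l hl h0
  properlyOrdered := X.properlyOrdered.telescope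
  simple := X.simple.telescope
  homeomorph_cantorSet :=
    X.homeomorph_cantorSet.map fun f => (telescopeHomeomorph _ l hl h0).symm.trans f

theorem map_T_zpow {X Y : BVSystem} {h : X.Path → Y.Path} (hT : ∀ x, h (X.T x) = Y.T (h x))
    (n : ℤ) (x : X.Path) : h ((X.T ^ n) x) = (Y.T ^ n) (h x) := by
  have hpow : ∀ (n : ℕ) (x : X.Path), h ((X.T ^ n) x) = (Y.T ^ n) (h x) := by
    intro n
    induction n with
    | zero => exact fun _ => rfl
    | succ n ih =>
      intro x
      rw [pow_succ, pow_succ, Equiv.Perm.mul_apply, Equiv.Perm.mul_apply, ih, hT]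
  obtain ⟨n, rfl | rfl⟩ := n.eq_nat_or_neg
  · simpa using hpow n x
  · rw [zpow_neg, zpow_neg, zpow_natCast, zpow_natCast, Equiv.Perm.eq_inv_iff_eq, ← hpow,
      ← Equiv.Perm.mul_apply, mul_inv_cancel, Equiv.Perm.one_apply]

theorem coding_eq_iff {X : BVSystem} {k : ℕ} {x x' : X.Path} :
    X.coding k x = X.coding k x' ↔
      ∀ (n : ℤ) (i : ℕ), i < k → ((X.T ^ n) x).edge i = ((X.T ^ n) x').edge i :=
  ⟨fun h n i hi => congrFun (congrFun h n) ⟨i, hi⟩,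
    fun h => funext fun n => funext fun i => h n i i.2⟩

theorem coding_eq_mono {X : BVSystem} {k m : ℕ} (hkm : k ≤ m) {x x' : X.Path}
    (h : X.coding m x = X.coding m x') : X.coding k x = X.coding k x' :=
  coding_eq_iff.2 fun n i hi => coding_eq_iff.1 h n i (hi.trans_le hkm)

section Telescope

variable {X : BVSystem} {l : ℕ → ℕ} {hl : StrictMono l} {h0 : l 0 = 0}

theorem telescopePath_T (x : X.Path) :
    telescopePath l hl h0 (X.T x) = (X.telescope l hl h0).T (telescopePath l hl h0 x) :=
  telescopePath_vershikFun X.properlyOrdered (X.telescope l hl h0).properlyOrdered x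

theorem conjugate_telescope : X.Conjugate (X.telescope l hl h0) :=
  ⟨telescopeHomeomorph _ l hl h0, telescopePath_T, fun _ => isMinimal_telescopePath.2⟩

theorem telescopePath_T_zpow (n : ℤ) (x : X.Path) :
    telescopePath l hl h0 ((X.T ^ n) x) =
      ((X.telescope l hl h0).T ^ n) (telescopePath l hl h0 x) :=
  map_T_zpow (Y := X.telescope l hl h0) telescopePath_T n x

theorem coding_telescopePath {k : ℕ} {x x' : X.Path} :
    (X.telescope l hl h0).coding k (telescopePath l hl h0 x) =
      (X.telescope l hl h0).coding k (telescopePath l hl h0 x') ↔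
    X.coding (l k) x = X.coding (l k) x' := by
  refine (coding_eq_iff (X := X.telescope l hl h0)).trans
    (Iff.trans (forall_congr' fun n => ?_) coding_eq_iff.symm)
  rw [← telescopePath_T_zpow, ← telescopePath_T_zpow]
  refine ⟨fun h i hi => ?_, fun h i hi => ?_⟩
  · obtain ⟨j, h1, h2⟩ := exists_mem_block hl h0 i
    exact Path.segment_eq_iff.1 (h j (hl.lt_iff_lt.1 (h1.trans_lt hi))) i h1 h2
  · exact Path.segment_eq_iff.2 fun m _ hm =>
      h m (hm.trans_le (hl.monotone (Nat.succ_le_of_lt hi)))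

theorem hasCut_telescopePath {j : ℕ} {x x' : X.Path} :
    (X.telescope l hl h0).HasCut j (telescopePath l hl h0 x) (telescopePath l hl h0 x') ↔
      X.HasCut (l j) x x' := by
  refine exists_congr fun m => ?_
  rw [← telescopePath_T_zpow, ← telescopePath_T_zpow]
  exact and_congr minimalInto_telescopePath minimalInto_telescopePath

theorem isDepthPair_telescopePath {k : ℕ} {x x' : X.Path} :
    (X.telescope l hl h0).IsDepthPair k (telescopePath l hl h0 x) (telescopePath l hl h0 x') ↔
      x ≠ x' ∧ X.coding (l k) x = X.coding (l k) x' ∧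
        X.coding (l (k + 1)) x ≠ X.coding (l (k + 1)) x' :=
  and_congr telescopePath_injective.ne_iff
    (and_congr coding_telescopePath (not_congr coding_telescopePath))

theorem Nonexpansive.telescope (h : X.Nonexpansive) : (X.telescope l hl h0).Nonexpansive := by
  intro k hk
  obtain ⟨x, x', hne, hc⟩ := h (l k) (hk.trans hl.le_apply)
  exact ⟨_, _, telescopePath_injective.ne hne, coding_telescopePath.2 hc⟩

end Telescope

/-- If at all large depths the pairs have bounded cuts, then merging the initial levels into one
gives an untimed system. -/
theorem Nonexpansive.mem_C_U {X : BVSystem} (hX : X.Nonexpansive) {k₀ : ℕ} (hk₀ : 1 ≤ k₀)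
    (h : ∀ k, k₀ ≤ k → ∃ j, k < j ∧ ∀ x x' : X.Path, X.IsDepthPair k x x' → ¬ X.HasCut j x x') :
    X ∈ C U := by
  let l : ℕ → ℕ := fun i => if i = 0 then 0 else k₀ + i - 1
  have hlp : ∀ i, 1 ≤ i → l i = k₀ + i - 1 := fun i hi => if_neg (by omega)
  have h0 : l 0 = 0 := if_pos rfl
  have hl : StrictMono l := strictMono_nat_of_lt_succ fun i => by
    rcases i.eq_zero_or_pos with rfl | hi
    · rw [h0, hlp 1 le_rfl]; omega
    · rw [hlp i hi, hlp (i + 1) (by omega)]; omega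
  refine ⟨X.telescope l hl h0, ⟨hX.telescope, fun k hk => ?_⟩, conjugate_telescope⟩
  obtain ⟨j, hj, hcut⟩ := h (k₀ + k - 1) (by omega)
  refine ⟨j - k₀ + 1, by omega, fun y y' hy hc => ?_⟩
  obtain ⟨x, rfl⟩ := telescopePath_surjective (hl := hl) (h0 := h0) y
  obtain ⟨x', rfl⟩ := telescopePath_surjective (hl := hl) (h0 := h0) y'
  rw [isDepthPair_telescopePath, hlp k hk, hlp (k + 1) (by omega),
    show k₀ + (k + 1) - 1 = k₀ + k - 1 + 1 by omega] at hy
  rw [hasCut_telescopePath, hlp _ (by omega), show k₀ + (j - k₀ + 1) - 1 = j by omega] at hc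
  exact hcut x x' hy hc

/-- If there are arbitrarily large depths with pairs that have arbitrarily large cuts, then
telescoping to these depths gives a well timed system. -/
theorem Nonexpansive.mem_C_W {X : BVSystem} (hX : X.Nonexpansive)
    (h : ∀ k₀, 1 ≤ k₀ → ∃ k, k₀ ≤ k ∧
      ∀ j, k < j → ∃ x x' : X.Path, X.IsDepthPair k x x' ∧ X.HasCut j x x') :
    X ∈ C W := by
  choose! f hf hf' using h
  -- `l (i + 1)` is an unbounded depth larger than `l i`.
  let l : ℕ → ℕ := fun i => Nat.rec 0 (fun _ a => f (a + 1)) i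
  have hls : ∀ i, l (i + 1) = f (l i + 1) := fun _ => rfl
  have h0 : l 0 = 0 := rfl
  have hl : StrictMono l := strictMono_nat_of_lt_succ fun i => by
    rw [hls]
    exact hf _ (by omega)
  refine ⟨X.telescope l hl h0, ⟨hX.telescope, fun k hk j hj => ?_⟩, conjugate_telescope⟩
  obtain ⟨i, rfl⟩ : ∃ i, k = i + 1 := ⟨k - 1, by omega⟩
  obtain ⟨x, x', hx, hc⟩ := hf' (l i + 1) (by omega) (l j) (by rw [← hls]; exact hl hj)
  rw [← hls] at hx
  refine ⟨_, _, isDepthPair_telescopePath.2 ⟨hx.1, hx.2.1, fun heq => hx.2.2 ?_⟩,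
    hasCut_telescopePath.2 hc⟩
  exact coding_eq_mono (hl (Nat.lt_succ_self (i + 1))) heq

/-! ### Conjugate systems -/

instance (X : BVSystem) : CompactSpace X.Path := by
  obtain ⟨f⟩ := X.homeomorph_cantorSet
  have : CompactSpace cantorSet := isCompact_iff_compactSpace.1 isCompact_cantorSet
  exact f.symm.compactSpace

theorem isClopen_minimalInto (X : BVSystem) (j : ℕ) :
    IsClopen {x : X.Path | x.MinimalInto j} := by
  have : {x : X.Path | x.MinimalInto j} =
      ⋂ n ∈ Set.Iio j, (fun x : X.Path => x.edge n) ⁻¹' {e | IsMin e} := by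
    ext x
    simp [Path.MinimalInto]
  rw [this]
  exact (Set.finite_Iio j).isClopen_biInter fun n _ =>
    (isClopen_discrete _).preimage (Path.continuous_edge n)

theorem isClopen_cylinder {X : BVSystem} (x : X.Path) (j : ℕ) :
    IsClopen {y : X.Path | ∀ n, n < j → y.edge n = x.edge n} := by
  have : {y : X.Path | ∀ n, n < j → y.edge n = x.edge n} =
      ⋂ n ∈ Set.Iio j, (fun x : X.Path => x.edge n) ⁻¹' {x.edge n} := by
    ext y
    simp
  rw [this]
  exact (Set.finite_Iio j).isClopen_biInter fun n _ =>
    (isClopen_discrete _).preimage (Path.continuous_edge n)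

theorem exists_cylinder_subset {X : BVSystem} {s : Set X.Path} (hs : IsOpen s) {x : X.Path}
    (hx : x ∈ s) : ∃ K, ∀ y : X.Path, (∀ n, n < K → y.edge n = x.edge n) → y ∈ s := by
  obtain ⟨K, hK⟩ := exists_subset_nhds_of_compactSpace
    (V := fun K : ℕ => {y : X.Path | ∀ n, n < K → y.edge n = x.edge n})
    (directed_of_isDirected_le fun _ _ h _ hy n hn => hy n (lt_of_lt_of_le hn h))
    (fun K => (isClopen_cylinder x K).1) (U := s) (by
      intro y hy
      have : y = x := Path.ext' fun n => Set.mem_iInter.1 hy (n + 1) n n.lt_succ_self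
      rw [this]
      exact hs.mem_nhds hx)
  exact ⟨K, fun y hy => hK hy⟩

/-- By compactness, the first `k` edges of the image under a continuous map depend on finitely
many edges only. -/
theorem exists_modulus {X Y : BVSystem} {h : X.Path → Y.Path} (hh : Continuous h) (k : ℕ) :
    ∃ K, ∀ x x' : X.Path, (∀ n, n < K → x.edge n = x'.edge n) →
      ∀ n, n < k → (h x).edge n = (h x').edge n := by
  let s : ℕ → Set X.Path := fun K => {x | ∀ x' : X.Path, (∀ n, n < K → x'.edge n = x.edge n) →
      ∀ n, n < k → (h x').edge n = (h x).edge n}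
  have hopen : ∀ K, IsOpen (s K) := fun K => isOpen_iff_mem_nhds.2 fun x hx => by
    filter_upwards [(isClopen_cylinder x K).isOpen.mem_nhds fun _ _ => rfl] with y hy x' hx' n hn
    rw [hx x' (fun n hn => (hx' n hn).trans (hy n hn)) n hn, hx y hy n hn]
  have hcover : Set.univ ⊆ ⋃ K, s K := fun x _ => by
    obtain ⟨K, hK⟩ := exists_cylinder_subset
      ((isClopen_cylinder (h x) k).isOpen.preimage hh) (x := x) fun _ _ => rfl
    exact Set.mem_iUnion.2 ⟨K, hK⟩
  obtain ⟨K, hK⟩ := isCompact_univ.elim_directed_cover s hopen hcover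
    (directed_of_isDirected_le fun _ _ hab _ hx x' hx' =>
      hx x' fun n hn => hx' n (lt_of_lt_of_le hn hab))
  exact ⟨K, fun x x' hx => hK (Set.mem_univ x') x hx⟩

theorem Conjugate.symm {X Y : BVSystem} (h : X.Conjugate Y) : Y.Conjugate X := by
  obtain ⟨f, hT, hm⟩ := h
  refine ⟨f.symm, fun y => f.injective ?_, fun y hy => ?_⟩
  · rw [hT, f.apply_symm_apply, f.apply_symm_apply]
  · obtain ⟨x, hx, -⟩ := X.properlyOrdered.1
    rw [Y.properlyOrdered.1.unique hy (hm x hx), f.symm_apply_apply]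
    exact hx

theorem Conjugate.trans {X Y Z : BVSystem} (h : X.Conjugate Y) (h' : Y.Conjugate Z) :
    X.Conjugate Z := by
  obtain ⟨f, hT, hm⟩ := h
  obtain ⟨g, hT', hm'⟩ := h'
  refine ⟨f.trans g, fun x => ?_, fun x hx => hm' _ (hm x hx)⟩
  simp only [Homeomorph.trans_apply, hT, hT']

theorem exists_coding_eq_of_coding_eq {X Y : BVSystem} {h : X.Path → Y.Path} (hh : Continuous h)
    (hT : ∀ x, h (X.T x) = Y.T (h x)) (k : ℕ) :
    ∃ K, ∀ x x', X.coding K x = X.coding K x' → Y.coding k (h x) = Y.coding k (h x') := by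
  obtain ⟨K, hK⟩ := exists_modulus hh k
  refine ⟨K, fun x x' hx => coding_eq_iff.2 fun n => ?_⟩
  rw [← map_T_zpow hT, ← map_T_zpow hT]
  exact hK _ _ (coding_eq_iff.1 hx n)

/-- A conjugacy maps large cuts to large cuts: the paths that are minimal into level `i` shrink to
the minimal path as `i` grows, and the minimal path is mapped to the minimal path. -/
theorem exists_hasCut_of_hasCut {X Y : BVSystem} {h : X.Path → Y.Path} (hh : Continuous h)
    (hT : ∀ x, h (X.T x) = Y.T (h x)) (hm : ∀ x : X.Path, x.IsMinimal → (h x).IsMinimal) (j : ℕ) :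
    ∃ J, ∀ i, J ≤ i → ∀ x x', X.HasCut i x x' → Y.HasCut j (h x) (h x') := by
  obtain ⟨J, hJ⟩ := exists_subset_nhds_of_compactSpace
    (V := fun i : ℕ => {x : X.Path | x.MinimalInto i})
    (directed_of_isDirected_le fun _ _ hab _ hx n hn => hx n (lt_of_lt_of_le hn hab))
    (fun i => (isClopen_minimalInto X i).1) (U := h ⁻¹' {y | y.MinimalInto j}) (by
      intro x hx
      have hx' : x.IsMinimal := fun n => Set.mem_iInter.1 hx (n + 1) n n.lt_succ_self
      exact ((isClopen_minimalInto Y j).isOpen.preimage hh).mem_nhds fun n _ => hm x hx' n)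
  refine ⟨J, fun i hi x x' ⟨m, h1, h2⟩ => ⟨m, ?_⟩⟩
  rw [← map_T_zpow hT, ← map_T_zpow hT]
  exact ⟨hJ fun n hn => h1 n (hn.trans_le hi), hJ fun n hn => h2 n (hn.trans_le hi)⟩

theorem Nonexpansive.of_conjugate {X Y : BVSystem} (hX : X.Nonexpansive) (h : X.Conjugate Y) :
    Y.Nonexpansive := by
  intro k _
  obtain ⟨f, hT, -⟩ := h
  obtain ⟨K, hK⟩ := exists_coding_eq_of_coding_eq f.continuous hT k
  obtain ⟨x, x', hne, hx⟩ := hX (K + 1) (by omega)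
  exact ⟨f x, f x', f.injective.ne hne, hK x x' (coding_eq_mono K.le_succ hx)⟩

/-- Codings that agree at level `a` and differ at level `b` first differ somewhere in between. -/
theorem exists_isDepthPair {X : BVSystem} {a b : ℕ} {x x' : X.Path}
    (ha : X.coding a x = X.coding a x') (hb : X.coding b x ≠ X.coding b x') :
    ∃ d, a ≤ d ∧ d < b ∧ X.IsDepthPair d x x' := by
  classical
  have hex : ∃ n, X.coding n x ≠ X.coding n x' := ⟨b, hb⟩
  have hlt : a < Nat.find hex := by
    by_contra hle
    exact Nat.find_spec hex (coding_eq_mono (not_lt.1 hle) ha)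
  obtain ⟨d, hd⟩ : ∃ d, Nat.find hex = d + 1 := ⟨Nat.find hex - 1, by omega⟩
  have hle : Nat.find hex ≤ b := Nat.find_min' hex hb
  refine ⟨d, by omega, by omega, fun h => hb (by rw [h]), ?_, hd ▸ Nat.find_spec hex⟩
  exact not_not.1 (Nat.find_min hex (by omega))

/-- The pairs of one large depth in `Y` are mapped to pairs of finitely many depths in `Z`, so that
a common bound on their cuts is available in `Z`. -/
theorem not_conjugate_of_mem_W_of_mem_U {Y Z : BVSystem} (hY : Y ∈ W) (hZ : Z ∈ U) :
    ¬ Y.Conjugate Z := by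
  rintro ⟨f, hT, hm⟩
  have hT' : ∀ z, f.symm (Z.T z) = Y.T (f.symm z) := fun z => by
    rw [f.symm_apply_eq, hT, f.apply_symm_apply]
  -- Pairs of depth `K + 1` in `Y` have a depth `d` in `Z` with `1 ≤ d < L`.
  obtain ⟨K, hK⟩ := exists_coding_eq_of_coding_eq f.continuous hT 1
  obtain ⟨L, hL⟩ := exists_coding_eq_of_coding_eq f.symm.continuous hT' (K + 1 + 1)
  choose! g _ hg using hZ.2
  obtain ⟨J, hJ⟩ := exists_hasCut_of_hasCut f.continuous hT hm ((Finset.range L).sup g)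
  obtain ⟨y, y', hy, hcut⟩ := hY.2 (K + 1) (by omega) (max J (K + 2)) (by omega)
  obtain ⟨d, hd, hdL, hpair⟩ := exists_isDepthPair (X := Z) (x := f y) (x' := f y') (a := 1) (b := L)
    (hK y y' (coding_eq_mono K.le_succ hy.2.1)) (fun heq => hy.2.2 (by
      simpa using hL (f y) (f y') heq))
  obtain ⟨m, h1, h2⟩ := hJ _ (le_max_left _ _) y y' hcut
  have hgd : g d ≤ (Finset.range L).sup g := Finset.le_sup (Finset.mem_range.2 hdL)
  exact hg d hd _ _ hpair
    ⟨m, fun n hn => h1 n (hn.trans_le hgd), fun n hn => h2 n (hn.trans_le hgd)⟩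

end BVSystem

theorem theorem5p12 :
    BVSystem.NE = BVSystem.C BVSystem.W ∪ BVSystem.C BVSystem.U ∧
      Disjoint (BVSystem.C BVSystem.W) (BVSystem.C BVSystem.U) := by
  refine ⟨Set.Subset.antisymm (fun X hX => ?_) ?_, ?_⟩
  · by_cases h : ∃ k₀, 1 ≤ k₀ ∧ ∀ k, k₀ ≤ k → ∃ j, k < j ∧
        ∀ x x' : X.Path, X.IsDepthPair k x x' → ¬ X.HasCut j x x'
    · obtain ⟨k₀, hk₀, h⟩ := h
      exact Or.inr (BVSystem.Nonexpansive.mem_C_U hX hk₀ h)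
    · push Not at h
      exact Or.inl (BVSystem.Nonexpansive.mem_C_W hX h)
  · rintro X (⟨Y, hY, hXY⟩ | ⟨Y, hY, hXY⟩)
    · exact hY.1.of_conjugate hXY.symm
    · exact hY.1.of_conjugate hXY.symm
  · refine Set.disjoint_left.2 ?_
    rintro X ⟨Y, hY, hXY⟩ ⟨Z, hZ, hXZ⟩
    exact BVSystem.not_conjugate_of_mem_W_of_mem_U hY hZ (hXY.symm.trans hXZ)
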